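/- Let $\Bbbk$ be a field, $n\ge 0$, $L\subseteq\mathbb{Z}^n$ a lattice (i.e. a subgroup, of any rank), and let $I_L=\langle x^u-x^v : u,v\in\mathbb{N}^n,\ u-v\in L\rangle\subseteq \Bbbk[x_1,\dots,x_n]$ be its lattice ideal. A binomial is a difference $x^u-x^v$ of two monomials. A Markov basis of $I_L$ is an inclusion-minimal generating set of $I_L$ consisting of binomials, whose cardinality is the least possible value $\mu(I_L)$ among all such sets. The $I_L$-fiber of a monomial $x^u$ is $F_u=\{x^v : v\in\mathbb{N}^n,\ v-u\in L\}$, and for a nonzero binomial $B=x^u-x^v\in I_L$ put $F_B=F_u$ (this does not depend on how $B$ is written). Two $I_L$-fibers $F,G$ are equivalent, $F\equiv G$, if there are $u,v\in\mathbb{N}^n$ with $x^uF\subseteq G$ and $x^vG\subseteq F$; the equivalence class of $F$ is $\overline F=\{G : G \text{ is an } I_L\text{-fiber},\ G\equiv F\}$. If $S=\{B_1,\dots,B_\mu\}$ and $S'=\{B'_1,\dots,B'_\mu\}$ are Markov bases of $I_L$, where $\mu=\mu(I_L)$, then the multisets $\{\overline{F_{B_1}},\dots,\overline{F_{B_\mu}}\}$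 and $\{\overline{F_{B'_1}},\dots,\overline{F_{B'_\mu}}\}$ are equal. -/

import Mathlib

namespace LatticeIdeal

noncomputable section

/-- The monomial `x^u` of `𝕜[x_1, …, x_n]`. Over a field it determines the exponent vector
`u ∈ ℕ^n`; sets of monomials are represented below by their sets of exponent vectors. -/
abbrev mon (𝕜 : Type*) [Field 𝕜] {n : ℕ} (u : Fin n →₀ ℕ) : MvPolynomial (Fin n) 𝕜 :=
  MvPolynomial.monomial u 1

/-- The difference `u - v ∈ ℤ^n` of two exponent vectors. -/
def diff {n : ℕ} (u v : Fin n →₀ ℕ) : Fin n → ℤ := fun i => (u i : ℤ) - (v i : ℤ)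

/-- The lattice ideal `I_L = ⟨x^u - x^v : u - v ∈ L⟩` of a lattice (subgroup) `L ⊆ ℤ^n`. -/
def latticeIdeal (𝕜 : Type*) [Field 𝕜] {n : ℕ} (L : AddSubgroup (Fin n → ℤ)) :
    Ideal (MvPolynomial (Fin n) 𝕜) :=
  Ideal.span {f | ∃ u v : Fin n →₀ ℕ, diff u v ∈ L ∧ f = mon 𝕜 u - mon 𝕜 v}

/-- Binomials are the differences `x^u - x^v` of two monomials. -/
def IsBinomial {𝕜 : Type*} [Field 𝕜] {n : ℕ} (f : MvPolynomial (Fin n) 𝕜) : Prop :=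
  ∃ u v : Fin n →₀ ℕ, f = mon 𝕜 u - mon 𝕜 v

/-- `S` is a minimal (with respect to inclusion) system of binomial generators of `I`.
As the polynomial ring is Noetherian, such systems are finite. -/
def IsMinimalBinomialGeneratingSet {𝕜 : Type*} [Field 𝕜] {n : ℕ}
    (I : Ideal (MvPolynomial (Fin n) 𝕜)) (S : Finset (MvPolynomial (Fin n) 𝕜)) : Prop :=
  (∀ B ∈ S, IsBinomial B) ∧
    Ideal.span (S : Set (MvPolynomial (Fin n) 𝕜)) = I ∧
    ∀ T : Finset (MvPolynomial (Fin n) 𝕜), T ⊂ S →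
      Ideal.span (T : Set (MvPolynomial (Fin n) 𝕜)) ≠ I

/-- `μ(I)`: the least cardinality of a minimal system of binomial generators of `I`. -/
def mu {𝕜 : Type*} [Field 𝕜] {n : ℕ} (I : Ideal (MvPolynomial (Fin n) 𝕜)) : ℕ :=
  sInf {c | ∃ S : Finset (MvPolynomial (Fin n) 𝕜),
    IsMinimalBinomialGeneratingSet I S ∧ S.card = c}

/-- A Markov basis of `I`: a minimal system of binomial generators of cardinality `μ(I)`. -/
def IsMarkovBasis {𝕜 : Type*} [Field 𝕜] {n : ℕ}
    (I : Ideal (MvPolynomial (Fin n) 𝕜)) (S : Finset (MvPolynomial (Fin n) 𝕜)) : Prop :=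
  IsMinimalBinomialGeneratingSet I S ∧ S.card = mu I

/-- The fiber `F_u = {x^v : v - u ∈ L}`. -/
def fiber {n : ℕ} (L : AddSubgroup (Fin n → ℤ)) (u : Fin n →₀ ℕ) : Set (Fin n →₀ ℕ) :=
  {v | diff v u ∈ L}

/-- `F` is an `I_L`-fiber. -/
def IsFiber {n : ℕ} (L : AddSubgroup (Fin n → ℤ)) (F : Set (Fin n →₀ ℕ)) : Prop :=
  ∃ u, F = fiber L u

/-- The relation `F ≡ G`: there are `u, v ∈ ℕ^n` with `x^u F ⊆ G` and `x^v G ⊆ F`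
(multiplying monomials adds exponent vectors). -/
def FiberEquiv {n : ℕ} (F G : Set (Fin n →₀ ℕ)) : Prop :=
  ∃ u v : Fin n →₀ ℕ, (∀ w ∈ F, u + w ∈ G) ∧ (∀ w ∈ G, v + w ∈ F)

/-- The equivalence class `{G : G is an I_L-fiber, G ≡ F}` of a fiber `F`. -/
def fiberClass {n : ℕ} (L : AddSubgroup (Fin n → ℤ)) (F : Set (Fin n →₀ ℕ)) :
    Set (Set (Fin n →₀ ℕ)) :=
  {G | IsFiber L G ∧ FiberEquiv G F}

/-- The fiber `F_B` of a binomial `B ∈ I_L`: it is `F_u` if `0 ≠ B = x^u - x^v ∈ I_L`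
(`binomialFiber_eq` below). -/
def binomialFiber {𝕜 : Type*} [Field 𝕜] {n : ℕ} (L : AddSubgroup (Fin n → ℤ))
    (B : MvPolynomial (Fin n) 𝕜) : Set (Fin n →₀ ℕ) :=
  {w | ∃ u v : Fin n →₀ ℕ, B = mon 𝕜 u - mon 𝕜 v ∧ w ∈ fiber L u}

/-- The multiset of the classes of the fibers `F_B`, for `B` in a finite set `S` of binomials. -/
def fiberClassMultiset {𝕜 : Type*} [Field 𝕜] {n : ℕ} (L : AddSubgroup (Fin n → ℤ))
    (S : Finset (MvPolynomial (Fin n) 𝕜)) : Multiset (Set (Set (Fin n →₀ ℕ))) :=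
  S.val.map fun B => fiberClass L (binomialFiber L B)

/-- If `x^u - x^v ∈ I_L` then `u - v ∈ L`. -/
theorem diff_mem_of_sub_mem {𝕜 : Type*} [Field 𝕜] {n : ℕ} {L : AddSubgroup (Fin n → ℤ)}
    {u v : Fin n →₀ ℕ} (h : mon 𝕜 u - mon 𝕜 v ∈ latticeIdeal 𝕜 L) : diff u v ∈ L := by
  classical
  let d : (Fin n →₀ ℕ) →+ ((Fin n → ℤ) ⧸ L) :=
    { toFun := fun w => QuotientAddGroup.mk (fun i => (w i : ℤ))
      map_zero' := by
        refine (QuotientAddGroup.eq_zero_iff _).2 ?_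
        convert L.zero_mem using 1
        ext i; simp
      map_add' := fun a b => by
        rw [← QuotientAddGroup.mk_add]
        congr 1 }
  let φ : MvPolynomial (Fin n) 𝕜 →+* AddMonoidAlgebra 𝕜 ((Fin n → ℤ) ⧸ L) :=
    AddMonoidAlgebra.mapDomainRingHom 𝕜 d
  have hφ : ∀ w, φ (mon 𝕜 w) = AddMonoidAlgebra.single (d w) 1 := fun w => by
    exact AddMonoidAlgebra.mapDomain_single
  have hd : ∀ a b, d a = d b ↔ diff a b ∈ L := fun a b => by
    rw [← sub_eq_zero]
    change (QuotientAddGroup.mk _ - QuotientAddGroup.mk _ : (Fin n → ℤ) ⧸ L) = 0 ↔ _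
    rw [← QuotientAddGroup.mk_sub, QuotientAddGroup.eq_zero_iff]
    rfl
  have hker : latticeIdeal 𝕜 L ≤ RingHom.ker φ := by
    refine Ideal.span_le.2 ?_
    rintro f ⟨a, b, hab, rfl⟩
    simp only [SetLike.mem_coe, RingHom.mem_ker, map_sub, hφ, (hd a b).2 hab, sub_self]
  have h0 := hker h
  rw [RingHom.mem_ker, map_sub, hφ, hφ, sub_eq_zero] at h0
  refine (hd u v).1 ?_
  exact AddMonoidAlgebra.single_left_injective one_ne_zero h0

/-- The fiber of a nonzero binomial of `I_L` does not depend on how the binomial is written. -/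
theorem binomialFiber_eq {𝕜 : Type*} [Field 𝕜] {n : ℕ} {L : AddSubgroup (Fin n → ℤ)}
    {u v : Fin n →₀ ℕ} (huv : u ≠ v) (h : mon 𝕜 u - mon 𝕜 v ∈ latticeIdeal 𝕜 L) :
    binomialFiber L (mon 𝕜 u - mon 𝕜 v) = fiber L u := by
  classical
  have hL := diff_mem_of_sub_mem h
  ext w
  constructor
  · rintro ⟨a, b, hab, hw⟩
    have hc := congrArg (MvPolynomial.coeff u) hab
    simp only [MvPolynomial.coeff_sub, MvPolynomial.coeff_monomial, if_true,
      if_neg (Ne.symm huv)] at hc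
    by_cases ha : a = u
    · exact ha ▸ hw
    · have hb : b = u := by
        by_contra hb
        simp [ha, hb] at hc
      have hc' := congrArg (MvPolynomial.coeff v) hab
      subst hb
      have hav : a = v := by
        by_contra hav
        simp [huv, hav] at hc'
      subst hav
      have h2 := L.sub_mem hw hL
      have e : diff w b = diff w a - diff b a := by
        ext i; simp [diff]
      exact show diff w b ∈ L from e ▸ h2
  · intro hw
    exact ⟨u, v, rfl, hw⟩

end

end LatticeIdeal

/-!
The ideal `I_L` is homogeneous for the grading by `ℤ^n / L`, in which fibers are sets of monomials
of equal degree, so every binomial of `I_L` lies in the ideal spanned by those generators of a given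
system whose fibers divide its own. Hence, in a minimal binomial generating set `S`, the generators
of one fiber class `c` may be exchanged for those of the same class in any other binomial generating
set `S'`: a generator of class `c` is a combination of elements of `S'` whose fibers divide its own,
and those among them outside `c` are combinations of elements of `S` outside `c`. If `S` has the
least possible cardinality, it therefore has at most as many elements in the class `c` as `S'`.
-/

namespace LatticeIdeal

open MvPolynomial

theorem span_le_span_exchange {R M : Type*} [Semiring R] [AddCommMonoid M] [Module R M]
    (r : M → M → Prop) {S S' C : Set M}
    (hSS' : ∀ x ∈ S, x ∈ Submodule.span R {y ∈ S' | r y x})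
    (hS'S : ∀ y ∈ S', y ∈ Submodule.span R {x ∈ S | r x y})
    (hC : ∀ x ∈ S ∩ C, ∀ z ∈ S ∩ C, ∀ y, r x y → r y z → y ∈ C) :
    Submodule.span R S ≤ Submodule.span R (S \ C ∪ S' ∩ C) := by
  refine Submodule.span_le.2 fun z hz => ?_
  by_cases hzC : z ∈ C
  case neg => exact Submodule.subset_span (.inl ⟨hz, hzC⟩)
  refine Submodule.span_le.2 ?_ (hSS' z hz)
  rintro y ⟨hy, hyz⟩
  by_cases hyC : y ∈ C
  case pos => exact Submodule.subset_span (.inr ⟨hy, hyC⟩)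
  -- A generator `x ∈ C` occurring in `y` would force `y ∈ C`, as `r x y` and `r y z`.
  refine Submodule.span_mono ?_ (hS'S y hy)
  rintro x ⟨hx, hxy⟩
  exact .inl ⟨hx, fun hxC => hyC (hC x ⟨hx, hxC⟩ z ⟨hz, hzC⟩ y hxy hyz)⟩

theorem mem_span_of_isWeightedHomogeneous {R σ M : Type*} [CommSemiring R] [AddCommMonoid M]
    {w : σ → M} {S : Set (MvPolynomial σ R)} (hS : ∀ g ∈ S, ∃ d, IsWeightedHomogeneous w g d)
    {f : MvPolynomial σ R} {m : M} (hf : IsWeightedHomogeneous w f m) (hfS : f ∈ Ideal.span S) :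
    f ∈ Ideal.span {g ∈ S | ∃ (u : σ →₀ ℕ) (d : M),
      IsWeightedHomogeneous w g d ∧ Finsupp.weight w u + d = m} := by
  classical
  set J := Ideal.span {g ∈ S | ∃ (u : σ →₀ ℕ) (d : M),
    IsWeightedHomogeneous w g d ∧ Finsupp.weight w u + d = m}
  suffices h : weightedHomogeneousComponent w m f ∈ J by
    rwa [hf.weightedHomogeneousComponent_same] at h
  clear hf
  induction hfS using Submodule.closure_induction with
  | zero => simp only [map_zero, J.zero_mem]
  | add f g _ _ hf hg => exact map_add (weightedHomogeneousComponent w m) f g ▸ J.add_mem hf hg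
  | smul_mem p g hg =>
    obtain ⟨d, hd⟩ := hS g hg
    rw [smul_eq_mul]
    induction p using MvPolynomial.induction_on' with
    | monomial u c =>
      have hmul := (isWeightedHomogeneous_monomial w u c rfl).mul hd
      rw [weightedHomogeneousComponent_of_mem hmul]
      split_ifs with hm
      · exact J.mul_mem_left _ (Ideal.subset_span ⟨hg, u, d, hd, hm.symm⟩)
      · exact J.zero_mem
    | add p q hp hq =>
      rw [add_mul, map_add]
      exact J.add_mem hp hq

/-- Divisibility of fibers: `F` divides `G` if `x^u F ⊆ G` for some `u`. Two fibers are equivalent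
when each divides the other. -/
def FiberDvd {n : ℕ} (F G : Set (Fin n →₀ ℕ)) : Prop :=
  ∃ u : Fin n →₀ ℕ, ∀ w ∈ F, u + w ∈ G

section Fibers

variable {n : ℕ} {L : AddSubgroup (Fin n → ℤ)} {F G H : Set (Fin n →₀ ℕ)}

theorem FiberDvd.refl (F : Set (Fin n →₀ ℕ)) : FiberDvd F F :=
  ⟨0, fun w hw => (zero_add w).symm ▸ hw⟩

theorem FiberDvd.trans : FiberDvd F G → FiberDvd G H → FiberDvd F H :=
  fun ⟨u, hu⟩ ⟨v, hv⟩ => ⟨v + u, fun w hw => (add_assoc v u w).symm ▸ hv _ (hu w hw)⟩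

theorem fiberEquiv_iff_fiberDvd : FiberEquiv F G ↔ FiberDvd F G ∧ FiberDvd G F :=
  ⟨fun ⟨u, v, hu, hv⟩ => ⟨⟨u, hu⟩, v, hv⟩, fun ⟨⟨u, hu⟩, v, hv⟩ => ⟨u, v, hu, hv⟩⟩

theorem fiberClass_eq_iff_fiberDvd (hF : IsFiber L F) :
    fiberClass L F = fiberClass L G ↔ FiberDvd F G ∧ FiberDvd G F := by
  constructor
  · intro h
    have hFF : F ∈ fiberClass L F := ⟨hF, fiberEquiv_iff_fiberDvd.2 ⟨.refl F, .refl F⟩⟩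
    exact fiberEquiv_iff_fiberDvd.1 (h ▸ hFF).2
  · rintro ⟨hFG, hGF⟩
    ext H
    simp only [fiberClass, Set.mem_ofPred_eq, fiberEquiv_iff_fiberDvd]
    exact ⟨fun ⟨hH, hHF, hFH⟩ => ⟨hH, hHF.trans hFG, hGF.trans hFH⟩,
      fun ⟨hH, hHG, hGH⟩ => ⟨hH, hHG.trans hGF, hFG.trans hGH⟩⟩

/-- The degrees of the variables in the grading of the polynomial ring by `ℤ^n / L`, whose
homogeneous monomials of a given degree form an `I_L`-fiber. -/
def varDegree (L : AddSubgroup (Fin n → ℤ)) (i : Fin n) : (Fin n → ℤ) ⧸ L :=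
  QuotientAddGroup.mk (Pi.single i 1)

theorem weight_varDegree (L : AddSubgroup (Fin n → ℤ)) (u : Fin n →₀ ℕ) :
    Finsupp.weight (varDegree L) u = QuotientAddGroup.mk fun i => (u i : ℤ) := by
  have hu : (fun i => (u i : ℤ)) = ∑ i, u i • (Pi.single i 1 : Fin n → ℤ) := by
    ext j
    simp [Finset.sum_apply, Pi.single_apply]
  rw [Finsupp.weight_apply, Finsupp.sum_fintype _ _ (by simp), hu,
    ← QuotientAddGroup.mk'_apply, map_sum]
  rfl

theorem weight_varDegree_eq_iff {u v : Fin n →₀ ℕ} :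
    Finsupp.weight (varDegree L) u = Finsupp.weight (varDegree L) v ↔ diff u v ∈ L := by
  rw [weight_varDegree, weight_varDegree, ← sub_eq_zero, ← QuotientAddGroup.mk_sub,
    QuotientAddGroup.eq_zero_iff]
  rfl

end Fibers

section Binomials

variable {𝕜 : Type*} [Field 𝕜] {n : ℕ} {L : AddSubgroup (Fin n → ℤ)}
  {B : MvPolynomial (Fin n) 𝕜}

theorem IsBinomial.exists_isWeightedHomogeneous (hB : IsBinomial B)
    (hBL : B ∈ latticeIdeal 𝕜 L) : ∃ d, IsWeightedHomogeneous (varDegree L) B d := by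
  obtain ⟨u, v, rfl⟩ := hB
  have huv := weight_varDegree_eq_iff.2 (diff_mem_of_sub_mem hBL)
  exact ⟨_, (weightedHomogeneousSubmodule 𝕜 (varDegree L) _).sub_mem
    (isWeightedHomogeneous_monomial _ u 1 huv) (isWeightedHomogeneous_monomial _ v 1 rfl)⟩

theorem IsBinomial.isFiber_binomialFiber (hB : IsBinomial B) (hB0 : B ≠ 0)
    (hBL : B ∈ latticeIdeal 𝕜 L) : IsFiber L (binomialFiber L B) := by
  obtain ⟨u, v, rfl⟩ := hB
  exact ⟨u, binomialFiber_eq (fun huv => hB0 (huv ▸ sub_self _)) hBL⟩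

theorem IsBinomial.binomialFiber_eq_setOf_weight (hB : IsBinomial B) (hB0 : B ≠ 0)
    {d : (Fin n → ℤ) ⧸ L} (hd : IsWeightedHomogeneous (varDegree L) B d) :
    binomialFiber L B = {w | Finsupp.weight (varDegree L) w = d} := by
  classical
  obtain ⟨u, v, rfl⟩ := hB
  have huv : u ≠ v := fun huv => hB0 (huv ▸ sub_self _)
  have hu : Finsupp.weight (varDegree L) u = d := hd (by simp [coeff_monomial, huv.symm])
  have hv : Finsupp.weight (varDegree L) v = d := hd (by simp [coeff_monomial, huv])
  have hdiff : diff u v ∈ L := weight_varDegree_eq_iff.1 (hu.trans hv.symm)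
  rw [binomialFiber_eq huv (Ideal.subset_span ⟨u, v, hdiff, rfl⟩), ← hu]
  exact Set.ext fun w => weight_varDegree_eq_iff.symm

theorem IsBinomial.mem_span_fiberDvd (hB : IsBinomial B) {S : Set (MvPolynomial (Fin n) 𝕜)}
    (hS : ∀ C ∈ S, IsBinomial C) (hSL : S ⊆ latticeIdeal 𝕜 L) (hBS : B ∈ Ideal.span S) :
    B ∈ Ideal.span {C ∈ S | FiberDvd (binomialFiber L C) (binomialFiber L B)} := by
  rcases eq_or_ne B 0 with rfl | hB0
  · exact Ideal.zero_mem _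
  obtain ⟨m, hm⟩ := hB.exists_isWeightedHomogeneous (Ideal.span_le.2 hSL hBS)
  have hBS' : B ∈ Ideal.span (S \ {0}) := by
    rwa [Ideal.span, Submodule.span_sdiff_singleton_zero]
  refine Ideal.span_mono ?_ (mem_span_of_isWeightedHomogeneous
    (fun C hC => (hS C hC.1).exists_isWeightedHomogeneous (hSL hC.1)) hm hBS')
  rintro C ⟨⟨hCS, hC0⟩, u, d, hd, rfl⟩
  rw [Set.mem_ofPred_eq, (hS C hCS).binomialFiber_eq_setOf_weight hC0 hd,
    hB.binomialFiber_eq_setOf_weight hB0 hm]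
  exact ⟨hCS, u, fun w hw => (map_add _ u w).trans (congrArg _ hw)⟩

end Binomials

section GeneratingSets

variable {𝕜 : Type*} [Field 𝕜] {n : ℕ} {I : Ideal (MvPolynomial (Fin n) 𝕜)}
  {L : AddSubgroup (Fin n → ℤ)} {S S' : Finset (MvPolynomial (Fin n) 𝕜)}

theorem IsMinimalBinomialGeneratingSet.ne_zero (hS : IsMinimalBinomialGeneratingSet I S)
    {B : MvPolynomial (Fin n) 𝕜} (hB : B ∈ S) : B ≠ 0 := by
  classical
  rintro rfl
  refine hS.2.2 _ (Finset.erase_ssubset hB) ?_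
  rw [← hS.2.1, Finset.coe_erase]
  exact Submodule.span_sdiff_singleton_zero

theorem mu_le_card (hS : ∀ B ∈ S, IsBinomial B) (hSI : Ideal.span (S : Set _) = I) :
    mu I ≤ S.card := by
  obtain ⟨T, hTS, hT⟩ := exists_minimal_le_of_wellFoundedLT
    (fun T : Finset (MvPolynomial (Fin n) 𝕜) => Ideal.span (T : Set _) = I) S hSI
  have hTmin : IsMinimalBinomialGeneratingSet I T :=
    ⟨fun B hB => hS B (hTS hB), hT.prop, fun U hU => hT.not_prop_of_lt hU⟩
  calc mu I ≤ T.card := Nat.sInf_le ⟨T, hTmin, rfl⟩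
    _ ≤ S.card := Finset.card_le_card hTS

theorem span_exchange_fiberClass (hS : IsMinimalBinomialGeneratingSet (latticeIdeal 𝕜 L) S)
    (hS' : ∀ B ∈ S', IsBinomial B) (hS'L : Ideal.span (S' : Set _) = latticeIdeal 𝕜 L)
    (c : Set (Set (Fin n →₀ ℕ))) :
    Ideal.span ((S : Set (MvPolynomial (Fin n) 𝕜)) \ {B | fiberClass L (binomialFiber L B) = c} ∪
      S' ∩ {B | fiberClass L (binomialFiber L B) = c}) = latticeIdeal 𝕜 L := by
  have ⟨hSbin, hSL, _⟩ := hS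
  have hSsub : (S : Set (MvPolynomial (Fin n) 𝕜)) ⊆ latticeIdeal 𝕜 L := Ideal.span_le.1 hSL.le
  have hS'sub : (S' : Set (MvPolynomial (Fin n) 𝕜)) ⊆ latticeIdeal 𝕜 L := Ideal.span_le.1 hS'L.le
  refine le_antisymm (Ideal.span_le.2 (Set.union_subset (Set.sdiff_subset.trans hSsub)
    (Set.inter_subset_left.trans hS'sub))) (hSL.ge.trans ?_)
  refine span_le_span_exchange (fun B C => FiberDvd (binomialFiber L B) (binomialFiber L C))
    (fun B hB => (hSbin B hB).mem_span_fiberDvd hS' hS'sub (hS'L ▸ hSsub hB))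
    (fun B hB => (hS' B hB).mem_span_fiberDvd hSbin hSsub (hSL ▸ hS'sub hB)) ?_
  rintro A ⟨hA, hAc⟩ C ⟨-, hCc⟩ B hAB hBC
  have hAfib := (hSbin A hA).isFiber_binomialFiber (hS.ne_zero hA) (hSsub hA)
  have hCA := ((fiberClass_eq_iff_fiberDvd hAfib).1 (hAc.trans hCc.symm)).2
  exact ((fiberClass_eq_iff_fiberDvd hAfib).2 ⟨hAB, hBC.trans hCA⟩).symm.trans hAc

open Classical in
theorem IsMarkovBasis.card_filter_fiberClass_le (hS : IsMarkovBasis (latticeIdeal 𝕜 L) S)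
    (hS' : ∀ B ∈ S', IsBinomial B) (hS'L : Ideal.span (S' : Set _) = latticeIdeal 𝕜 L)
    (c : Set (Set (Fin n →₀ ℕ))) :
    {B ∈ S | fiberClass L (binomialFiber L B) = c}.card ≤
      {B ∈ S' | fiberClass L (binomialFiber L B) = c}.card := by
  set A := {B ∈ S | fiberClass L (binomialFiber L B) = c}
  set N := {B ∈ S | ¬fiberClass L (binomialFiber L B) = c}
  set A' := {B ∈ S' | fiberClass L (binomialFiber L B) = c}
  have hbin : ∀ B ∈ N ∪ A', IsBinomial B := fun B hB =>
    (Finset.mem_union.1 hB).elim (fun h => hS.1.1 B (Finset.mem_filter.1 h).1)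
      (fun h => hS' B (Finset.mem_filter.1 h).1)
  have hspan : Ideal.span ((N ∪ A' : Finset _) : Set _) = latticeIdeal 𝕜 L := by
    rw [← span_exchange_fiberClass hS.1 hS' hS'L c]
    congr 1
    ext B
    simp [N, A']
  refine le_of_add_le_add_left (a := N.card) ?_
  calc N.card + A.card = S.card := (add_comm _ _).trans (S.card_filter_add_card_filter_not _)
    _ = mu (latticeIdeal 𝕜 L) := hS.2
    _ ≤ (N ∪ A').card := mu_le_card hbin hspan
    _ ≤ N.card + A'.card := Finset.card_union_le _ _

open Classical in
theorem count_fiberClassMultiset (L : AddSubgroup (Fin n → ℤ))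
    (S : Finset (MvPolynomial (Fin n) 𝕜)) (c : Set (Set (Fin n →₀ ℕ))) :
    (fiberClassMultiset L S).count c = {B ∈ S | fiberClass L (binomialFiber L B) = c}.card := by
  simp only [fiberClassMultiset, Multiset.count_map, Finset.card_def, Finset.filter_val, eq_comm]

end GeneratingSets

end LatticeIdeal

open LatticeIdeal Classical in
theorem corollary4p11_general {𝕜 : Type*} [Field 𝕜] {n : ℕ} {L : AddSubgroup (Fin n → ℤ)}
    {S S' : Finset (MvPolynomial (Fin n) 𝕜)} (hS : IsMarkovBasis (latticeIdeal 𝕜 L) S)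
    (hS' : ∀ B ∈ S', IsBinomial B) (hS'L : Ideal.span (S' : Set _) = latticeIdeal 𝕜 L) :
    fiberClassMultiset L S ≤ fiberClassMultiset L S' := by
  refine Multiset.le_iff_count.2 fun c => ?_
  rw [count_fiberClassMultiset, count_fiberClassMultiset]
  exact hS.card_filter_fiberClass_le hS' hS'L c

theorem corollary4p11 (𝕜 : Type*) [Field 𝕜] (n : ℕ) (L : AddSubgroup (Fin n → ℤ))
    (S S' : Finset (MvPolynomial (Fin n) 𝕜))
    (hS : LatticeIdeal.IsMarkovBasis (LatticeIdeal.latticeIdeal 𝕜 L) S)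
    (hS' : LatticeIdeal.IsMarkovBasis (LatticeIdeal.latticeIdeal 𝕜 L) S') :
    LatticeIdeal.fiberClassMultiset L S = LatticeIdeal.fiberClassMultiset L S' :=
  le_antisymm (corollary4p11_general hS hS'.1.1 hS'.1.2.1)
    (corollary4p11_general hS' hS.1.1 hS.1.2.1)
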